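/- Conventions. Let $\omega_1$ be the first uncountable ordinal and let $[0,\omega_1)$ carry the order topology. All compact spaces are Hausdorff, $C(K^n)$ is the Banach space of real continuous functions on $K^n$ with the supremum norm, and a space is scattered if each of its nonempty subsets has a relatively isolated point. For a partition $F_1,\dots,F_k$ of $\{1,\dots,m\}$, a point $(x_1,\dots,x_m)\in K^m$ is $(F_1,\dots,F_k)$-diverse if $\{x_j:j\in F_i\}\cap\{x_j:j\notin F_i\}=\emptyset$ for all $1\le i\le k$. The compact space $K$ is $n$-diverse if for every $m$ and every partition $F_1,\dots,F_k$ of $\{1,\dots,m\}$ with $k\le n$, every sequence $(x^\alpha)_{\alpha<\omega_1}$ of $(F_1,\dots,F_k)$-diverse points of $K^m$ has a cluster point (a point each neighbourhood of which contains $x^\alpha$ for infinitely many $\alpha$) that is $(F_1,\dots,F_k)$-diverse. A Banach space $X$ is half-pcc if every point-finite family of half-spaces $\{x\in X: x^*(x)>a\}$ ($x^*\in X^*$, $a\in\mathbb{R}$) is countable. A complemented copy of $c_0(\omega_1)$ in $X$ is a subspace of $X$ that is linearly homeomorphic to $c_0(\omega_1)$ and is the range of a bounded linear projection on $X$. A map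 is $k$-to-$1$ if each of its fibres has at most $k$ elements. Theorem. Let $K$ be a compact, totally disconnected Hausdorff space and $n\in\mathbb{N}$. Consider the conditions (1) $K$ is $(n+1)$-diverse; (2) $C(K^n)$ is half-pcc; (3) $C(K^n)$ contains no complemented copy of $c_0(\omega_1)$; (4) there is no point $\infty\in K$ such that $K\setminus\{\infty\}$ can be mapped onto $[0,\omega_1)$ by an $(n-1)$-to-$1$ continuous map. Then (2) implies (3), and (3) implies (4). If moreover $K$ is scattered, then (1) implies (2). -/

import Mathlib

open Set Filter Topology
open scoped Ordinal ENNReal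

/-- The set `[0, ω₁)` of all countable ordinals. As a topological space it carries the subspace
topology of the order topology on the ordinals, which is its own order topology. -/
abbrev CountableOrdinals : Type 1 := Set.Iio (ω₁ : Ordinal.{0})

/-- A topological space is scattered if every nonempty subset `S` has a point that is isolated
in `S`. -/
def IsScattered (K : Type*) [TopologicalSpace K] : Prop :=
  ∀ S : Set K, S.Nonempty → ∃ x ∈ S, ∃ U : Set K, IsOpen U ∧ U ∩ S = {x}

/-- `F₁, …, F_k` is a partition of `{1, …, m}`. Empty parts are allowed; for the notion of an
`n`-diverse space below this makes no difference, as empty parts can be left out and only the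
bound `k ≤ n` on the number of parts matters. -/
def IsPartition {m k : ℕ} (F : Fin k → Set (Fin m)) : Prop :=
  (Pairwise fun i j => Disjoint (F i) (F j)) ∧ ⋃ i, F i = Set.univ

/-- The point `(x₁, …, x_m) ∈ K^m` is `(F₁, …, F_k)`-diverse: for each `i`, the sets
`{x_j : j ∈ F_i}` and `{x_j : j ∉ F_i}` are disjoint. -/
def IsDiversePoint {K : Type*} {m k : ℕ} (F : Fin k → Set (Fin m)) (x : Fin m → K) : Prop :=
  ∀ i, Disjoint (x '' F i) (x '' (F i)ᶜ)

/-- `x` is a cluster point of the sequence `(u_α)_{α<ω₁}`: every neighbourhood of `x` contains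
`u_α` for infinitely many indices `α`. -/
def IsClusterPointOf {X : Type*} [TopologicalSpace X] (x : X) (u : CountableOrdinals → X) : Prop :=
  ∀ U ∈ 𝓝 x, {α | u α ∈ U}.Infinite

/-- `K` is `n`-diverse: for every `m` and every partition `F₁, …, F_k` of `{1, …, m}` with `k ≤ n`,
each sequence `(x^α)_{α<ω₁}` of `(F₁, …, F_k)`-diverse points of `K^m` has a cluster point which is
`(F₁, …, F_k)`-diverse. -/
def IsDiverseSpace (n : ℕ) (K : Type*) [TopologicalSpace K] : Prop :=
  ∀ (m k : ℕ), k ≤ n → ∀ F : Fin k → Set (Fin m), IsPartition F →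
    ∀ u : CountableOrdinals → (Fin m → K), (∀ α, IsDiversePoint F (u α)) →
      ∃ x : Fin m → K, IsClusterPointOf x u ∧ IsDiversePoint F x

/-- Half-spaces of a real normed space: the sets `{x | x*(x) > a}`, with `x*` a continuous linear
functional and `a` a real number. -/
def IsHalfSpace {X : Type*} [NormedAddCommGroup X] [NormedSpace ℝ X] (H : Set X) : Prop :=
  ∃ (φ : X →L[ℝ] ℝ) (a : ℝ), H = {x | a < φ x}

/-- A family of sets is point-finite if each point lies in only finitely many members. -/
def IsPointFinite {X : Type*} (𝓗 : Set (Set X)) : Prop :=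
  ∀ x : X, {H | H ∈ 𝓗 ∧ x ∈ H}.Finite

/-- `X` is half-pcc: every point-finite family of half-spaces of `X` is countable. -/
def IsHalfPcc (X : Type*) [NormedAddCommGroup X] [NormedSpace ℝ X] : Prop :=
  ∀ 𝓗 : Set (Set X), (∀ H ∈ 𝓗, IsHalfSpace H) → IsPointFinite 𝓗 → 𝓗.Countable

/-- The Banach space `c₀(Γ)`, as a subspace of `ℓ^∞(Γ)` with the supremum norm: those
`f : Γ → ℝ` such that, for every `ε > 0`, `|f γ| ≥ ε` for only finitely many `γ`. -/
def cZero (Γ : Type*) : Submodule ℝ (lp (fun _ : Γ => ℝ) ∞) where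
  carrier := {f | Tendsto (fun γ => f γ) cofinite (𝓝 0)}
  zero_mem' := by
    simpa using (tendsto_const_nhds : Tendsto (fun _ : Γ => (0 : ℝ)) cofinite (𝓝 0))
  add_mem' := by
    intro f g hf hg
    simpa using Tendsto.add (show Tendsto (fun γ => f γ) cofinite (𝓝 0) from hf)
      (show Tendsto (fun γ => g γ) cofinite (𝓝 0) from hg)
  smul_mem' := by
    intro c f hf
    simpa using Tendsto.const_mul c (show Tendsto (fun γ => f γ) cofinite (𝓝 0) from hf)

/-- `X` contains a complemented isomorphic copy of `Z`: there is a subspace `Y` of `X` that is the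
range of a bounded linear projection of `X` and is linearly homeomorphic to `Z`. -/
def HasComplementedCopy (Z X : Type*) [NormedAddCommGroup Z] [NormedSpace ℝ Z]
    [NormedAddCommGroup X] [NormedSpace ℝ X] : Prop :=
  ∃ Y : Submodule ℝ X, Y.ClosedComplemented ∧ Nonempty (Y ≃L[ℝ] Z)

/-- `f` is a `k`-to-`1` map: every fibre has at most `k` elements. -/
def IsToOne {X Y : Type*} (k : ℕ) (f : X → Y) : Prop :=
  ∀ y : Y, (f ⁻¹' {y}).encard ≤ k

/-!
The three implications have independent proofs.

*Diversity implies half-pcc.* A functional `φ` on `C(K^n)` restricts to a bounded finitely additive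
function `U ↦ φ(1_U)` on the clopen subsets of `K^n`, nonzero if `φ ≠ 0`. Since `K^n` is scattered,
such a function behaves like a purely atomic measure, and only the following trace of this is used
(`IsBoundedCharge.exists_dominant_atom`): there are a point `x`, some `δ > 0` and a finite set
`S` not containing `x` with `δ ≤ |φ(1_W)|` for all clopen `W` that contain `x` and miss `S`. Given
uncountably many half-spaces `{φ > a}`, list the coordinates of the points of `{x} ∪ S` injectively
as `y = (y_1, …, y_m)`, so that `x = y ∘ g` and each point of `S` is `y ∘ h` for some `h ≠ g`; after
passing to uncountably many half-spaces, `m`, `g` and a bound `N` for `a / δ` are fixed. The tuples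
`y` are diverse for the partition of the indices into the singletons `{g i}` and the remainder,
which has at most `n + 1` parts, so they have a cluster point `w` with `w ∘ h ≠ w ∘ g` for all
`h ≠ g`. A clopen set `W` containing `w ∘ g` and none of the `w ∘ h` then gives infinitely many of
the half-spaces containing `N • 1_W` or `-N • 1_W`, and the family is not point-finite.

*Half-pcc excludes complemented copies of `c₀(ω₁)`.* The half-spaces on which the coordinates of the
projection onto such a copy exceed `1` form an uncountable point-finite family.

*Maps onto `[0, ω₁)` give complemented copies.* Choose `x^α_i` over the `i`-th isolated point of the
block `[ω·α, ω·(α+1))`. The functional `∑_σ sgn σ ⊗_j (δ_{x_{σ j}} - δ_p)` depends continuously on the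
tuple `x` and vanishes when two of the points `x_1, …, x_n, p` coincide. A limit of the tuples `x^α`
along increasing `α` has all its coordinates in the union of `{p}` and one fibre, a set with at most
`n` elements, so by the pigeonhole principle the functionals tend to zero pointwise
(`tendsto_alternatingDifference`) and define an operator from `C(K^n)` to `c₀(ω₁)`. Disjoint clopen
boxes around the `x^α` define a right inverse of it, whose range is complemented.
-/

open TopologicalSpace (Clopens)

/-! ### Induction over the clopen subsets of a scattered space -/

/-- A finite product of scattered spaces is scattered. -/
theorem IsScattered.pi {ι K : Type*} [Finite ι] [TopologicalSpace K] (hK : IsScattered K) :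
    IsScattered (ι → K) := by
  classical
  cases nonempty_fintype ι
  intro S hS
  -- Coordinates are frozen one at a time, passing to a relatively open subset at each step.
  have key : ∀ s : Finset ι, ∃ U : Set (ι → K), IsOpen U ∧ (U ∩ S).Nonempty ∧
      ∀ y ∈ U ∩ S, ∀ z ∈ U ∩ S, ∀ i ∈ s, y i = z i := by
    intro s
    induction s using Finset.induction_on with
    | empty => exact ⟨univ, isOpen_univ, by simpa using hS, by simp⟩
    | insert i s _ ih =>
      obtain ⟨U, hU, hne, hs⟩ := ih
      obtain ⟨a, ⟨y, hy, hya⟩, V, hV, hVa⟩ := hK ((fun y : ι → K => y i) '' (U ∩ S)) (hne.image _)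
      have hVa' : ∀ y ∈ U ∩ S, y i ∈ V → y i = a := fun y hy h => by
        have : y i ∈ V ∩ (fun y : ι → K => y i) '' (U ∩ S) := ⟨h, y, hy, rfl⟩
        rwa [hVa] at this
      have haV : a ∈ V := (hVa.symm ▸ mem_singleton a : a ∈ V ∩ _).1
      refine ⟨U ∩ (fun y => y i) ⁻¹' V, hU.inter (hV.preimage (continuous_apply i)),
        ⟨y, ⟨hy.1, ?_⟩, hy.2⟩, ?_⟩
      · simpa [hya] using haV
      · rintro y ⟨⟨hyU, hyV⟩, hyS⟩ z ⟨⟨hzU, hzV⟩, hzS⟩ j hj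
        rcases Finset.mem_insert.1 hj with rfl | hj
        · rw [hVa' y ⟨hyU, hyS⟩ hyV, hVa' z ⟨hzU, hzS⟩ hzV]
        · exact hs y ⟨hyU, hyS⟩ z ⟨hzU, hzS⟩ j hj
  obtain ⟨U, hU, ⟨x, hx⟩, h⟩ := key Finset.univ
  refine ⟨x, hx.2, U, hU, Subset.antisymm (fun y hy => ?_) (singleton_subset_iff.2 hx)⟩
  exact funext fun i => h y hy x hx i (Finset.mem_univ i)

section Charge

variable {X : Type*} [TopologicalSpace X]

/-- A property of clopen sets that passes to clopen subsets and to finite unions holds for `U` as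
soon as it holds locally at each point of `U`. -/
theorem Clopens.of_forall_mem [CompactSpace X] {P : Clopens X → Prop} (hbot : P ⊥)
    (hmono : ∀ U V, V ≤ U → P U → P V) (hsup : ∀ U V, P U → P V → P (U ⊔ V)) (U : Clopens X)
    (h : ∀ x ∈ U, ∃ V : Clopens X, x ∈ V ∧ P V) : P U := by
  have : ∃ V : Clopens X, (U : Set X) ⊆ V ∧ P V := by
    refine U.isClopen.isClosed.isCompact.induction_on
      (p := fun s => ∃ V : Clopens X, s ⊆ V ∧ P V) ⟨⊥, by simp, hbot⟩ ?_ ?_ ?_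
    · rintro s t hst ⟨V, htV, hV⟩
      exact ⟨V, hst.trans htV, hV⟩
    · rintro s t ⟨V, hsV, hV⟩ ⟨W, htW, hW⟩
      exact ⟨V ⊔ W, by simpa using union_subset_union hsV htW, hsup V W hV hW⟩
    · intro x hx
      obtain ⟨V, hxV, hV⟩ := h x hx
      exact ⟨V, mem_nhdsWithin_of_mem_nhds (V.isClopen.isOpen.mem_nhds hxV), V, subset_rfl, hV⟩
  obtain ⟨V, hUV, hV⟩ := this
  exact hmono V U hUV hV

/-- Induction over the clopen subsets of a scattered compact space: the points with no
neighbourhood satisfying `P` form a closed set, and an isolated point of this set contradicts the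
hypothesis `hpoint`. -/
theorem IsScattered.clopen_induction [CompactSpace X] [T2Space X] [TotallyDisconnectedSpace X]
    (hX : IsScattered X) {P : Clopens X → Prop} (hbot : P ⊥)
    (hmono : ∀ U V, V ≤ U → P U → P V) (hsup : ∀ U V, P U → P V → P (U ⊔ V))
    (hpoint : ∀ (x : X) (U : Clopens X), x ∈ U → (∀ V ≤ U, x ∉ V → P V) → P U) (U : Clopens X) :
    P U := by
  refine Clopens.of_forall_mem hbot hmono hsup U fun x _ => ?_
  by_contra hx
  obtain ⟨y, hy, O, hO, hOy⟩ := hX {x | ¬ ∃ V : Clopens X, x ∈ V ∧ P V} ⟨x, hx⟩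
  have hyO : y ∈ O := (hOy.symm ▸ mem_singleton y : y ∈ O ∩ _).1
  obtain ⟨V, hV, hyV, hVO⟩ := compact_exists_isClopen_in_isOpen hO hyO
  refine hy ⟨⟨V, hV⟩, hyV, hpoint y ⟨V, hV⟩ hyV fun W hWV hyW => ?_⟩
  refine Clopens.of_forall_mem hbot hmono hsup W fun z hz => ?_
  by_contra hbad
  have : z ∈ O ∩ {x | ¬ ∃ V : Clopens X, x ∈ V ∧ P V} := ⟨hVO (hWV hz), hbad⟩
  rw [hOy] at this
  exact hyW (this ▸ hz)

/-! ### Bounded finitely additive functions on the clopen sets -/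

/-- A bounded, finitely additive real-valued function on the Boolean algebra of clopen sets. -/
structure IsBoundedCharge (m : Clopens X → ℝ) : Prop where
  /-- Additivity on disjoint clopen sets. -/
  add : ∀ U V, Disjoint U V → m (U ⊔ V) = m U + m V
  /-- Boundedness. -/
  bdd : ∃ C, ∀ U, |m U| ≤ C

namespace IsBoundedCharge

variable {m : Clopens X → ℝ}

theorem inf_add_sdiff (hm : IsBoundedCharge m) (W U : Clopens X) : m (W ⊓ U) + m (W \ U) = m W := by
  rw [← hm.add _ _ (disjoint_inf_sdiff), sup_inf_sdiff]

theorem map_bot (hm : IsBoundedCharge m) : m ⊥ = 0 := by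
  simpa using hm.add ⊥ ⊥ disjoint_bot_left

theorem neg (hm : IsBoundedCharge m) : IsBoundedCharge fun U => -m U where
  add U V h := by rw [hm.add U V h]; ring
  bdd := by simpa using hm.bdd

/-- One-sided form of `exists_nhd_abs_le`: the neighbourhood is the complement of a clopen set
whose charge is almost maximal among the clopen sets missing `x`. -/
theorem exists_nhd_le (hm : IsBoundedCharge m) (x : X) {ε : ℝ} (hε : 0 < ε) :
    ∃ U : Clopens X, x ∈ U ∧ ∀ W ≤ U, x ∉ W → m W ≤ ε := by
  obtain ⟨C, hC⟩ := hm.bdd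
  have hne : (m '' {V | x ∉ V}).Nonempty := ⟨_, ⊥, fun h => h, rfl⟩
  have hbdd : BddAbove (m '' {V | x ∉ V}) := by
    refine ⟨C, ?_⟩
    rintro _ ⟨V, -, rfl⟩
    exact (le_abs_self _).trans (hC V)
  obtain ⟨_, ⟨V, hV, rfl⟩, hlt⟩ := exists_lt_of_lt_csSup hne (sub_lt_self _ hε)
  refine ⟨Vᶜ, hV, fun W hW hxW => ?_⟩
  have hdisj : Disjoint V W := (disjoint_compl_right (a := V)).mono_right hW
  have hmem : x ∉ V ⊔ W := fun h => h.elim hV hxW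
  have := le_csSup hbdd ⟨V ⊔ W, hmem, rfl⟩
  rw [hm.add V W hdisj] at this
  linarith

/-- Near a point `x`, a bounded charge is concentrated at `x` up to an arbitrarily small error. -/
theorem exists_nhd_abs_le (hm : IsBoundedCharge m) (x : X) {ε : ℝ} (hε : 0 < ε) :
    ∃ U : Clopens X, x ∈ U ∧ ∀ W ≤ U, x ∉ W → |m W| ≤ ε := by
  obtain ⟨U, hxU, hU⟩ := hm.exists_nhd_le x hε
  obtain ⟨V, hxV, hV⟩ := hm.neg.exists_nhd_le x hε
  refine ⟨U ⊓ V, ⟨hxU, hxV⟩, fun W hW hxW => abs_le.2 ⟨?_, ?_⟩⟩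
  · linarith [hV W (hW.trans inf_le_right) hxW]
  · exact hU W (hW.trans inf_le_left) hxW

variable [CompactSpace X] [T2Space X] [TotallyDisconnectedSpace X]

/-- On a scattered compact space, a bounded charge is small off a finite set. -/
theorem exists_finite_abs_le (hm : IsBoundedCharge m) (hX : IsScattered X) {ε : ℝ} (hε : 0 < ε) :
    ∃ S : Set X, S.Finite ∧ ∀ W : Clopens X, Disjoint (W : Set X) S → |m W| ≤ ε := by
  have key := hX.clopen_induction (P := fun U => ∀ ε > 0, ∃ S : Set X, S.Finite ∧
    ∀ W ≤ U, Disjoint (W : Set X) S → |m W| ≤ ε) ?_ ?_ ?_ ?_ ⊤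
  · obtain ⟨S, hS, h⟩ := key ε hε
    exact ⟨S, hS, fun W => h W le_top⟩
  · intro ε hε
    refine ⟨∅, finite_empty, fun W hW _ => ?_⟩
    rw [le_bot_iff.1 hW, hm.map_bot, abs_zero]
    exact hε.le
  · intro U V hVU hU ε hε
    obtain ⟨S, hS, h⟩ := hU ε hε
    exact ⟨S, hS, fun W hW => h W (hW.trans hVU)⟩
  · intro U V hU hV ε hε
    obtain ⟨S, hS, h⟩ := hU (ε / 2) (by linarith)
    obtain ⟨T, hT, h'⟩ := hV (ε / 2) (by linarith)
    refine ⟨S ∪ T, hS.union hT, fun W hW hdisj => ?_⟩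
    rw [disjoint_union_right] at hdisj
    have h1 := h (W ⊓ U) inf_le_right (hdisj.1.mono_left fun y hy => hy.1)
    have h2 := h' (W \ U) (sdiff_le_iff.2 hW) (hdisj.2.mono_left fun y hy => hy.1)
    rw [← hm.inf_add_sdiff W U]
    exact (abs_add_le _ _).trans (by linarith)
  · intro x U _ h ε hε
    obtain ⟨O, hxO, hO⟩ := hm.exists_nhd_abs_le x (half_pos hε)
    obtain ⟨S, hS, h'⟩ := h (U \ O) sdiff_le (fun hx => hx.2 hxO) (ε / 2) (half_pos hε)
    refine ⟨insert x S, hS.insert x, fun W hW hdisj => ?_⟩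
    rw [disjoint_insert_right] at hdisj
    have h1 := hO (W ⊓ O) inf_le_right fun hx => hdisj.1 hx.1
    have h2 := h' (W \ O) (sdiff_le_sdiff_right hW) (hdisj.2.mono_left fun y hy => hy.1)
    rw [← hm.inf_add_sdiff W O]
    exact (abs_add_le _ _).trans (by linarith)

/-- A nonzero charge on a scattered compact space restricts to a nonzero multiple of a point mass
on some clopen set. -/
theorem exists_atom (hm : IsBoundedCharge m) (hX : IsScattered X) (h0 : ∃ W, m W ≠ 0) :
    ∃ (x : X) (U : Clopens X), x ∈ U ∧ m U ≠ 0 ∧ ∀ W ≤ U, x ∉ W → m W = 0 := by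
  by_contra! hno
  obtain ⟨W, hW⟩ := h0
  refine hW (hX.clopen_induction (P := fun U => ∀ W ≤ U, m W = 0) ?_ ?_ ?_ ?_ ⊤ W le_top)
  · intro W hW
    rw [le_bot_iff.1 hW, hm.map_bot]
  · exact fun U V hVU hU W hW => hU W (hW.trans hVU)
  · intro U V hU hV W hW
    rw [← hm.inf_add_sdiff W U, hU _ inf_le_right, hV _ (sdiff_le_iff.2 hW), add_zero]
  · intro x U _ h W hWU
    by_cases hxW : x ∈ W
    · by_contra hne
      obtain ⟨V, hVW, hxV, hV⟩ := hno x W hxW hne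
      exact hV (h V (hVW.trans hWU) hxV V le_rfl)
    · exact h W hWU hxW W le_rfl

/-- A nonzero charge on a scattered compact space has an atom `x` whose mass is not cancelled by
the rest of the charge once finitely many other points are avoided. -/
theorem exists_dominant_atom (hm : IsBoundedCharge m) (hX : IsScattered X) (h0 : ∃ W, m W ≠ 0) :
    ∃ (x : X) (δ : ℝ) (S : Set X), 0 < δ ∧ S.Finite ∧ x ∉ S ∧
      ∀ W : Clopens X, x ∈ W → Disjoint (W : Set X) S → δ ≤ |m W| := by
  obtain ⟨x, U, hxU, hU, hx⟩ := hm.exists_atom hX h0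
  have hpos := half_pos (abs_pos.2 hU)
  obtain ⟨S, hS, h⟩ := hm.exists_finite_abs_le hX hpos
  refine ⟨x, |m U| / 2, S \ U, hpos, hS.subset sdiff_subset, fun hxS => hxS.2 hxU, ?_⟩
  intro W hxW hdisj
  have h1 : m (W ⊓ U) = m U := by
    rw [← hm.inf_add_sdiff U W, hx (U \ W) sdiff_le (fun hx => hx.2 hxW), add_zero, inf_comm]
  have h2 : |m (W \ U)| ≤ |m U| / 2 := by
    refine h _ (disjoint_left.2 fun y hy hyS => ?_)
    exact disjoint_left.1 hdisj hy.1 ⟨hyS, hy.2⟩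
  rw [← hm.inf_add_sdiff W U, h1]
  have h3 := abs_sub_abs_le_abs_sub (m U) (-m (W \ U))
  rw [abs_neg, sub_neg_eq_add] at h3
  linarith

end IsBoundedCharge

/-- The indicator function of a clopen set, as a continuous function. -/
noncomputable def clopenIndicator (U : Clopens X) : C(X, ℝ) :=
  (LocallyConstant.charFn ℝ U.isClopen : LocallyConstant X ℝ)

theorem clopenIndicator_apply (U : Clopens X) (x : X) :
    clopenIndicator U x = (U : Set X).indicator 1 x := rfl

theorem clopenIndicator_of_mem {U : Clopens X} {x : X} (hx : x ∈ U) : clopenIndicator U x = 1 :=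
  indicator_of_mem (s := (U : Set X)) hx _

theorem clopenIndicator_of_notMem {U : Clopens X} {x : X} (hx : x ∉ U) :
    clopenIndicator U x = 0 :=
  indicator_of_notMem (s := (U : Set X)) hx _

variable [CompactSpace X]

theorem isBoundedCharge_clopenIndicator (φ : C(X, ℝ) →L[ℝ] ℝ) :
    IsBoundedCharge fun U => φ (clopenIndicator U) where
  add U V h := by
    rw [← map_add]
    congr 1
    ext x
    have h' : Disjoint (U : Set X) V := disjoint_left.2 fun y hyU hyV =>
      (h.le_bot (⟨hyU, hyV⟩ : y ∈ U ⊓ V) : y ∈ (⊥ : Clopens X))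
    simp only [ContinuousMap.add_apply, clopenIndicator_apply, TopologicalSpace.Clopens.coe_sup]
    exact congr_fun (indicator_union_of_disjoint h' _) x
  bdd := by
    refine ⟨‖φ‖, fun U => ?_⟩
    have h1 : ‖clopenIndicator U‖ ≤ 1 := by
      refine (ContinuousMap.norm_le _ zero_le_one).2 fun x => ?_
      by_cases hx : x ∈ U
      · simp [clopenIndicator_of_mem hx]
      · simp [clopenIndicator_of_notMem hx]
    simpa using φ.le_of_opNorm_le_of_le le_rfl h1

/-- A functional vanishing on the indicators of clopen sets is zero, by the Stone–Weierstrass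
theorem. -/
theorem eq_zero_of_clopenIndicator [T2Space X] [TotallyDisconnectedSpace X] (φ : C(X, ℝ) →L[ℝ] ℝ)
    (h : ∀ U : Clopens X, φ (clopenIndicator U) = 0) : φ = 0 := by
  classical
  have hloc : ∀ f : LocallyConstant X ℝ, φ (f : C(X, ℝ)) = 0 := by
    intro f
    have hsum : (f : C(X, ℝ)) = ∑ y ∈ f.range_finite.toFinset,
        y • clopenIndicator ⟨f ⁻¹' {y}, f.isLocallyConstant.isClopen_fiber y⟩ := by
      ext x
      rw [ContinuousMap.sum_apply, Finset.sum_eq_single (f x)]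
      · rw [ContinuousMap.smul_apply, clopenIndicator_of_mem (by exact rfl)]
        simp
      · intro y _ hy
        rw [ContinuousMap.smul_apply, clopenIndicator_of_notMem (by exact hy.symm), smul_zero]
      · simp
    rw [hsum, map_sum]
    exact Finset.sum_eq_zero fun y _ => by rw [map_smul, h, smul_zero]
  have hdense := ContinuousMap.subalgebra_topologicalClosure_eq_top_of_separatesPoints _
    (LocallyConstant.separatesPoints_range_toContinuousMapAlgHom (X := X) (Y := ℝ) ℝ)
  have hclosed : IsClosed {f : C(X, ℝ) | φ f = 0} := isClosed_eq φ.continuous continuous_const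
  ext f
  have hf : f ∈ (LocallyConstant.toContinuousMapAlgHom (X := X) (Y := ℝ) ℝ).range.topologicalClosure
    := hdense ▸ Algebra.mem_top
  refine closure_minimal ?_ hclosed hf
  rintro _ ⟨g, rfl⟩
  exact hloc g

end Charge

/-! ### Diverse scattered spaces have half-pcc function spaces -/

/-- An uncountable set contains an injective sequence of length `ω₁`. -/
theorem exists_injective_countableOrdinals.{v} {α : Type v} {s : Set α} (hs : ¬ s.Countable) :
    ∃ u : CountableOrdinals → α, Function.Injective u ∧ ∀ i, u i ∈ s := by
  have h1 : Cardinal.mk CountableOrdinals = Cardinal.aleph 1 := by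
    rw [Cardinal.mk_Iio_ordinal]
    simp
  have h2 : Cardinal.aleph 1 ≤ Cardinal.mk s := by
    rw [← Cardinal.succ_aleph0, Order.succ_le_iff, ← not_le]
    rwa [Cardinal.mk_le_aleph0_iff]
  have h3 : Cardinal.lift.{v} (Cardinal.mk CountableOrdinals) ≤ Cardinal.lift.{1} (Cardinal.mk s) := by
    rw [h1]
    simpa using h2
  obtain ⟨e⟩ := Cardinal.lift_mk_le'.1 h3
  exact ⟨fun i => e i, fun i j h => e.injective (Subtype.ext h), fun i => (e i).2⟩

theorem exists_fiber_not_countable {α β : Type*} [Countable β] {s : Set α} (hs : ¬ s.Countable)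
    (f : α → β) : ∃ b, ¬ {a ∈ s | f a = b}.Countable := by
  by_contra! h
  refine hs ((countable_iUnion h).mono fun a ha => ?_)
  exact mem_iUnion.2 ⟨f a, ha, rfl⟩

/-- The partition of `{1, …, m}` into the singletons `{g i}` and the complement of the range of `g`.
A value taken several times by `g` is listed at its first index only, the later parts being
empty. -/
def singletonPartition {n m : ℕ} (g : Fin n → Fin m) : Fin (n + 1) → Set (Fin m) :=
  Fin.snoc (α := fun _ => Set (Fin m)) (fun i => {j | j = g i ∧ ∀ i' < i, g i' ≠ g i}) (range g)ᶜ

theorem isPartition_singletonPartition {n m : ℕ} (g : Fin n → Fin m) :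
    IsPartition (singletonPartition g) := by
  constructor
  · intro a b hab
    induction a using Fin.lastCases with
    | last =>
      induction b using Fin.lastCases with
      | last => exact absurd rfl hab
      | cast i =>
        simp only [singletonPartition, Fin.snoc_last, Fin.snoc_castSucc]
        refine disjoint_left.2 fun j hj hj' => hj ⟨i, hj'.1.symm⟩
    | cast i =>
      induction b using Fin.lastCases with
      | last =>
        simp only [singletonPartition, Fin.snoc_last, Fin.snoc_castSucc]
        refine disjoint_left.2 fun j hj hj' => hj' ⟨i, hj.1.symm⟩
      | cast i' =>
        simp only [singletonPartition, Fin.snoc_castSucc]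
        refine disjoint_left.2 fun j hj hj' => ?_
        have hne : i ≠ i' := fun h => hab (by rw [h])
        rcases hne.lt_or_gt with h | h
        · exact hj'.2 i h (hj.1.symm.trans hj'.1)
        · exact hj.2 i' h (hj'.1.symm.trans hj.1)
  · refine eq_univ_of_forall fun j => ?_
    by_cases hj : j ∈ range g
    · obtain ⟨i, hi, hmin⟩ := WellFounded.has_min (wellFounded_lt (α := Fin n)) {i | g i = j} hj
      refine mem_iUnion.2 ⟨i.castSucc, ?_⟩
      simp only [singletonPartition, Fin.snoc_castSucc]
      exact ⟨hi.symm, fun i' hi' h => hmin i' (h.trans hi) hi'⟩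
    · refine mem_iUnion.2 ⟨Fin.last n, ?_⟩
      simp only [singletonPartition, Fin.snoc_last]
      exact hj

/-- Diversity with respect to `singletonPartition g` says that the coordinates indexed by the range
of `g` differ from all other coordinates. -/
theorem IsDiversePoint.ne_of_singletonPartition {K : Type*} {n m : ℕ} {g : Fin n → Fin m}
    {y : Fin m → K} (hy : IsDiversePoint (singletonPartition g) y) (i : Fin n) {j : Fin m}
    (hj : j ≠ g i) : y j ≠ y (g i) := by
  intro h
  obtain ⟨i₀, hi₀, hmin⟩ :=
    WellFounded.has_min (wellFounded_lt (α := Fin n)) {i' | g i' = g i} ⟨i, rfl⟩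
  have hd := hy i₀.castSucc
  simp only [singletonPartition, Fin.snoc_castSucc] at hd
  refine Set.disjoint_left.1 hd ⟨g i, ⟨hi₀.symm, ?_⟩, rfl⟩ ⟨j, ?_, h⟩
  · exact fun i' hi' h' => hmin i' (h'.trans hi₀) hi'
  · exact fun hj' => hj (hj'.1.trans hi₀)

/-- Finitely many points of `K^n`, one of them distinguished, are described by a single injective
tuple listing their coordinates. -/
theorem exists_coordinate_tuple {K : Type*} {n : ℕ} (x : Fin n → K) {S : Set (Fin n → K)}
    (hS : S.Finite) (hx : x ∉ S) :
    ∃ (m : ℕ) (y : Fin m → K) (g : Fin n → Fin m), Function.Injective y ∧ y ∘ g = x ∧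
      ∀ z ∈ S, ∃ h : Fin n → Fin m, h ≠ g ∧ y ∘ h = z := by
  have hfin : (⋃ z ∈ insert x S, range z).Finite :=
    (hS.insert x).biUnion fun z _ => finite_range z
  obtain ⟨m, y, hy, hr⟩ := hfin.fin_param
  have hex : ∀ z ∈ insert x S, ∃ h : Fin n → Fin m, y ∘ h = z := by
    intro z hz
    have : ∀ i, ∃ j, y j = z i := fun i => by
      have : z i ∈ range y := hr ▸ mem_biUnion hz (mem_range_self i)
      exact this
    choose h hh using this
    exact ⟨h, funext hh⟩
  obtain ⟨g, hg⟩ := hex x (mem_insert _ _)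
  refine ⟨m, y, g, hy, hg, fun z hz => ?_⟩
  obtain ⟨h, hh⟩ := hex z (mem_insert_of_mem _ hz)
  refine ⟨h, ?_, hh⟩
  rintro rfl
  exact hx (hg.symm.trans hh ▸ hz)

theorem isHalfPcc_of_isDiverseSpace {K : Type*} [TopologicalSpace K] [CompactSpace K] [T2Space K]
    [TotallyDisconnectedSpace K] {n : ℕ} (hK : IsScattered K) (hdiv : IsDiverseSpace (n + 1) K) :
    IsHalfPcc C(Fin n → K, ℝ) := by
  classical
  intro 𝓗 hhalf hfin
  by_contra hunc
  -- Half-spaces containing `0` and the empty half-space are discarded.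
  have hunc' : ¬ {H ∈ 𝓗 | (0 : C(Fin n → K, ℝ)) ∉ H ∧ H.Nonempty}.Countable := by
    intro hc
    refine hunc (((hc.union (hfin 0).countable).union (countable_singleton ∅)).mono ?_)
    intro H hH
    by_cases h0 : (0 : C(Fin n → K, ℝ)) ∈ H
    · exact Or.inl (Or.inr ⟨hH, h0⟩)
    · rcases H.eq_empty_or_nonempty with he | hne
      · exact Or.inr he
      · exact Or.inl (Or.inl ⟨hH, h0, hne⟩)
  -- `N` makes the half-space contain `N` or `-N` times the indicator of each clopen set that
  -- contains the point `y ∘ g` and none of the points `y ∘ h` with `h ≠ g`.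
  have hcode : ∀ H ∈ {H ∈ 𝓗 | (0 : C(Fin n → K, ℝ)) ∉ H ∧ H.Nonempty},
      ∃ (c : (Σ m : ℕ, (Fin n → Fin m)) × ℕ) (y : Fin c.1.1 → K), Function.Injective y ∧
        ∀ W : Clopens (Fin n → K), y ∘ c.1.2 ∈ W → (∀ h, h ≠ c.1.2 → y ∘ h ∉ W) →
          (c.2 : ℝ) • clopenIndicator W ∈ H ∨ (-c.2 : ℝ) • clopenIndicator W ∈ H := by
    rintro H ⟨hH, h0, f, hf⟩
    obtain ⟨φ, a, rfl⟩ := hhalf H hH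
    have ha : 0 ≤ a := by simpa using h0
    have hφ : ∃ W, φ (clopenIndicator W) ≠ 0 := by
      by_contra! hz
      rw [eq_zero_of_clopenIndicator φ hz] at hf
      exact absurd hf (not_lt.2 ha)
    obtain ⟨x, δ, S, hδ, hS, hxS, hW⟩ :=
      (isBoundedCharge_clopenIndicator φ).exists_dominant_atom hK.pi hφ
    obtain ⟨m, y, g, hy, hg, hSy⟩ := exists_coordinate_tuple x hS hxS
    obtain ⟨N, hN⟩ := exists_nat_gt (a / δ)
    refine ⟨⟨⟨m, g⟩, N⟩, y, hy, fun W hxW hmiss => ?_⟩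
    have hd : δ ≤ |φ (clopenIndicator W)| := by
      refine hW W (hg ▸ hxW) (disjoint_left.2 fun z hzW hzS => ?_)
      obtain ⟨h, hne, rfl⟩ := hSy z hzS
      exact hmiss h hne hzW
    have hlt : a < N * |φ (clopenIndicator W)| :=
      ((div_lt_iff₀ hδ).1 hN).trans_le (mul_le_mul_of_nonneg_left hd N.cast_nonneg)
    simp only [mem_ofPred_eq, map_smul, smul_eq_mul]
    rcases abs_choice (φ (clopenIndicator W)) with h | h <;> rw [h] at hlt
    · exact Or.inl hlt
    · exact Or.inr (by linarith)
  have : Nonempty ((Σ m : ℕ, (Fin n → Fin m)) × ℕ) := ⟨⟨n, id⟩, 0⟩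
  choose! c hc using hcode
  obtain ⟨⟨⟨m, g⟩, N⟩, hb⟩ := exists_fiber_not_countable hunc' c
  obtain ⟨u, hu, hub⟩ := exists_injective_countableOrdinals hb
  have hpts : ∀ i, ∃ z : Fin m → K, Function.Injective z ∧
      ∀ W : Clopens (Fin n → K), z ∘ g ∈ W → (∀ h, h ≠ g → z ∘ h ∉ W) →
        (N : ℝ) • clopenIndicator W ∈ u i ∨ (-N : ℝ) • clopenIndicator W ∈ u i := by
    intro i
    have := hc (u i) (hub i).1
    rwa [(hub i).2] at this
  choose z hz hzW using hpts
  obtain ⟨w, hw, hwdiv⟩ := hdiv m (n + 1) le_rfl (singletonPartition g)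
    (isPartition_singletonPartition g) z fun i k => (disjoint_image_iff (hz i)).2 disjoint_compl_right
  -- A clopen set separating `w ∘ g` from the other `w ∘ h`.
  have hopen : IsOpen (⋃ h ∈ {h : Fin n → Fin m | h ≠ g}, {w ∘ h})ᶜ :=
    ((toFinite {h : Fin n → Fin m | h ≠ g}).isClosed_biUnion
      fun h _ => isClosed_singleton).isOpen_compl
  have hwg : w ∘ g ∈ (⋃ h ∈ {h : Fin n → Fin m | h ≠ g}, {w ∘ h})ᶜ := by
    simp only [mem_compl_iff, mem_iUnion, not_exists, mem_singleton_iff]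
    intro h hne heq
    refine hne (funext fun i => ?_)
    by_contra hi
    exact hwdiv.ne_of_singletonPartition i hi (congr_fun heq i).symm
  obtain ⟨W, hW, hgW, hWsub⟩ := compact_exists_isClopen_in_isOpen hopen hwg
  have hcomp : ∀ h : Fin n → Fin m, Continuous fun v : Fin m → K => v ∘ h := fun h =>
    continuous_pi fun i => continuous_apply (h i)
  have hnhds : {v : Fin m → K | v ∘ g ∈ W ∧ ∀ h, h ≠ g → v ∘ h ∉ W} ∈ 𝓝 w := by
    refine inter_mem ((hcomp g).continuousAt.preimage_mem_nhds (hW.isOpen.mem_nhds hgW)) ?_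
    have : ∀ᶠ v in 𝓝 w, ∀ h, h ≠ g → v ∘ h ∉ W := by
      rw [eventually_all]
      intro h
      by_cases hne : h = g
      · simp [hne]
      · have hwh : w ∘ h ∉ W := fun hmem => hWsub hmem (mem_biUnion (show h ∈ {h | h ≠ g} from hne) rfl)
        filter_upwards [(hcomp h).continuousAt.preimage_mem_nhds
          (hW.compl.isOpen.mem_nhds hwh)] with v hv _ using hv
    exact this
  have hinf := hw _ hnhds
  refine hinf ?_
  have hf : ∀ f : C(Fin n → K, ℝ), {i | f ∈ u i}.Finite := fun f =>
    Finite.preimage hu.injOn (s := {H | H ∈ 𝓗 ∧ f ∈ H}) (hfin f) |>.subset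
      fun i hi => ⟨(hub i).1.1, hi⟩
  refine ((hf ((N : ℝ) • clopenIndicator ⟨W, hW⟩)).union
    (hf ((-N : ℝ) • clopenIndicator ⟨W, hW⟩))).subset fun i hi => ?_
  exact hzW i ⟨W, hW⟩ hi.1 hi.2

/-! ### Complemented copies of `c₀(Γ)` -/

/-- The unit vectors of `c₀(Γ)`. -/
noncomputable def cZero.single {Γ : Type*} [DecidableEq Γ] (γ : Γ) (c : ℝ) : cZero Γ :=
  ⟨lp.single ∞ γ c, by
    refine tendsto_nhds_of_eventually_eq ?_
    filter_upwards [(finite_singleton γ).compl_mem_cofinite] with i hi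
    exact lp.single_apply_ne (E := fun _ : Γ => ℝ) ∞ γ c hi⟩

theorem cZero.single_apply {Γ : Type*} [DecidableEq Γ] (γ : Γ) (c : ℝ) (i : Γ) :
    (cZero.single γ c : lp (fun _ : Γ => ℝ) ∞) i = if i = γ then c else 0 := by
  by_cases h : i = γ
  · subst h
    simp [cZero.single]
  · simp [cZero.single, h]

/-- The coordinate functionals of a complemented copy of `c₀(Γ)`, composed with the projection,
give a point-finite family of half-spaces indexed by `Γ`. -/
theorem not_hasComplementedCopy_of_isHalfPcc {Γ : Type*} [Uncountable Γ] {X : Type*}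
    [NormedAddCommGroup X] [NormedSpace ℝ X] (hX : IsHalfPcc X) :
    ¬ HasComplementedCopy (cZero Γ) X := by
  classical
  rintro ⟨Y, ⟨P, hP⟩, ⟨e⟩⟩
  let T : X →L[ℝ] cZero Γ := (e : Y →L[ℝ] cZero Γ).comp P
  let φ : Γ → X →L[ℝ] ℝ := fun γ =>
    (lp.evalCLM ℝ (fun _ : Γ => ℝ) ∞ γ).comp ((cZero Γ).subtypeL.comp T)
  have hφ : ∀ γ x, φ γ x = (T x : lp (fun _ : Γ => ℝ) ∞) γ := fun γ x => rfl
  have hTs : ∀ z : cZero Γ, T (e.symm z) = z := fun z => by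
    change e (P (e.symm z)) = z
    rw [hP, e.apply_symm_apply]
  have hinj : Function.Injective fun γ => {x | 1 < φ γ x} := by
    intro γ γ' h
    have hmem : ((e.symm (cZero.single γ 2) : Y) : X) ∈ {x | 1 < φ γ x} := by
      change 1 < φ γ _
      rw [hφ, hTs, cZero.single_apply, if_pos rfl]
      norm_num
    have h' : (e.symm (cZero.single γ 2) : X) ∈ {x | 1 < φ γ' x} := by
      rw [← show {x | 1 < φ γ x} = {x | 1 < φ γ' x} from h]
      exact hmem
    change 1 < φ γ' _ at h'
    rw [hφ, hTs, cZero.single_apply] at h'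
    by_contra hne
    rw [if_neg fun h => hne h.symm] at h'
    norm_num at h'
  have hcount := hX (range fun γ => {x | 1 < φ γ x}) ?_ ?_
  · exact not_countable_univ (preimage_range (fun γ => {x | 1 < φ γ x}) ▸
      hcount.preimage_of_injOn hinj.injOn)
  · rintro _ ⟨γ, rfl⟩
    exact ⟨φ γ, 1, rfl⟩
  · intro x
    have hx : Tendsto (fun γ => φ γ x) cofinite (𝓝 0) := (T x).2
    have hfin : {γ | 1 < φ γ x}.Finite := by
      have := hx.eventually (gt_mem_nhds zero_lt_one)
      refine Finite.subset this fun γ hγ h => ?_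
      exact absurd (show 1 < φ γ x from hγ) (not_lt.2 (le_of_lt h))
    refine (hfin.image fun γ => {x | 1 < φ γ x}).subset ?_
    rintro _ ⟨⟨γ, rfl⟩, hγ⟩
    exact ⟨γ, hγ, rfl⟩

theorem hasComplementedCopy_of_leftInverse {Z X : Type*} [NormedAddCommGroup Z] [NormedSpace ℝ Z]
    [NormedAddCommGroup X] [NormedSpace ℝ X] (S : Z →L[ℝ] X) (T : X →L[ℝ] Z)
    (h : Function.LeftInverse T S) : HasComplementedCopy Z X := by
  refine ⟨S.range, S.closedComplemented_range_of_leftInverse T h, ⟨?_⟩⟩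
  exact
    { toFun := fun y => T y
      map_add' := fun y z => by simp
      map_smul' := fun c y => by simp
      invFun := fun z => ⟨S z, z, rfl⟩
      left_inv := by
        rintro ⟨_, z, rfl⟩
        exact Subtype.ext (congrArg S (h z))
      right_inv := h
      continuous_toFun := T.continuous.comp continuous_subtype_val
      continuous_invFun := S.continuous.subtype_mk _ }

/-- The function equal to `f γ` on `U γ` for each `γ` and to `0` off the union of the sets `U γ`,
for pairwise disjoint `U γ`. -/
noncomputable def spread {X Γ : Type*} (U : Γ → Set X) (f : Γ → ℝ) (x : X) : ℝ :=
  open Classical in if h : ∃ γ, x ∈ U γ then f h.choose else 0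

section Spread

variable {X Γ : Type*} {U : Γ → Set X}

theorem spread_of_mem (hU : Pairwise fun i j => Disjoint (U i) (U j)) (f : Γ → ℝ) {γ : Γ} {x : X}
    (hx : x ∈ U γ) : spread U f x = f γ := by
  have h : ∃ γ, x ∈ U γ := ⟨γ, hx⟩
  rw [spread, dif_pos h]
  congr 1
  by_contra hne
  exact disjoint_left.1 (hU hne) h.choose_spec hx

theorem spread_of_notMem (f : Γ → ℝ) {x : X} (hx : ∀ γ, x ∉ U γ) : spread U f x = 0 :=
  dif_neg fun ⟨γ, h⟩ => hx γ h

theorem continuous_spread [TopologicalSpace X] (hU : Pairwise fun i j => Disjoint (U i) (U j))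
    (hclopen : ∀ γ, IsClopen (U γ)) {f : Γ → ℝ} (hf : Tendsto f cofinite (𝓝 0)) :
    Continuous (spread U f) := by
  refine continuous_iff_continuousAt.2 fun x => ?_
  by_cases hx : ∃ γ, x ∈ U γ
  · obtain ⟨γ, hγ⟩ := hx
    refine (continuousAt_const (y := f γ)).congr ?_
    filter_upwards [(hclopen γ).isOpen.mem_nhds hγ] with y hy
    rw [spread_of_mem hU f hy]
  · push Not at hx
    rw [ContinuousAt, spread_of_notMem f hx, Metric.tendsto_nhds]
    intro ε hε
    have hfin : {γ | ¬ dist (f γ) 0 < ε}.Finite := (Metric.tendsto_nhds.1 hf) ε hε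
    have hopen : IsOpen (⋃ γ ∈ {γ | ¬ dist (f γ) 0 < ε}, U γ)ᶜ :=
      (hfin.isClosed_biUnion fun γ _ => (hclopen γ).isClosed).isOpen_compl
    have hmem : x ∈ (⋃ γ ∈ {γ | ¬ dist (f γ) 0 < ε}, U γ)ᶜ := by
      simp only [mem_compl_iff, mem_iUnion, not_exists]
      exact fun γ _ => hx γ
    filter_upwards [hopen.mem_nhds hmem] with y hy
    by_cases hy' : ∃ γ, y ∈ U γ
    · obtain ⟨γ, hγ⟩ := hy'
      rw [spread_of_mem hU f hγ]
      by_contra hbig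
      exact hy (mem_biUnion (show γ ∈ {γ | ¬ dist (f γ) 0 < ε} from hbig) hγ)
    · push Not at hy'
      rw [spread_of_notMem f hy']
      simpa using hε

/-- The operator of norm at most `1` from `c₀(Γ)` to `C(X)` determined by pairwise disjoint clopen
sets, mapping the unit vectors to the indicator functions of these sets. -/
noncomputable def spreadCLM [TopologicalSpace X] [CompactSpace X]
    (hU : Pairwise fun i j => Disjoint (U i) (U j)) (hclopen : ∀ γ, IsClopen (U γ)) :
    cZero Γ →L[ℝ] C(X, ℝ) :=
  LinearMap.mkContinuous
    { toFun := fun f => ⟨spread U fun γ => f.1 γ, continuous_spread hU hclopen f.2⟩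
      map_add' := fun f g => by
        ext x
        change spread U _ x = spread U _ x + spread U _ x
        by_cases hx : ∃ γ, x ∈ U γ
        · obtain ⟨γ, hγ⟩ := hx
          rw [spread_of_mem hU _ hγ, spread_of_mem hU _ hγ, spread_of_mem hU _ hγ]
          rfl
        · push Not at hx
          rw [spread_of_notMem _ hx, spread_of_notMem _ hx, spread_of_notMem _ hx, add_zero]
      map_smul' := fun c f => by
        ext x
        change spread U _ x = c * spread U _ x
        by_cases hx : ∃ γ, x ∈ U γ
        · obtain ⟨γ, hγ⟩ := hx
          simp [spread_of_mem hU _ hγ]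
        · push Not at hx
          simp [spread_of_notMem _ hx] } 1 fun f => by
    rw [one_mul]
    refine (ContinuousMap.norm_le _ (norm_nonneg f)).2 fun x => ?_
    change ‖spread U (fun γ => f.1 γ) x‖ ≤ ‖f‖
    by_cases hx : ∃ γ, x ∈ U γ
    · obtain ⟨γ, hγ⟩ := hx
      rw [spread_of_mem hU _ hγ]
      exact lp.norm_apply_le_norm ENNReal.top_ne_zero f.1 γ
    · push Not at hx
      rw [spread_of_notMem _ hx, norm_zero]
      exact norm_nonneg f

theorem spreadCLM_apply [TopologicalSpace X] [CompactSpace X]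
    (hU : Pairwise fun i j => Disjoint (U i) (U j)) (hclopen : ∀ γ, IsClopen (U γ)) (f : cZero Γ)
    (x : X) : spreadCLM hU hclopen f x = spread U (fun γ => f.1 γ) x := rfl

end Spread

/-- A bounded family of functionals tending to zero pointwise, as an operator into `c₀(Γ)`. -/
noncomputable def toCZero {X Γ : Type*} [NormedAddCommGroup X] [NormedSpace ℝ X]
    (φ : Γ → X →ₗ[ℝ] ℝ) (C : ℝ) (hC : ∀ γ x, |φ γ x| ≤ C * ‖x‖)
    (h0 : ∀ x, Tendsto (fun γ => φ γ x) cofinite (𝓝 0)) : X →L[ℝ] cZero Γ :=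
  LinearMap.mkContinuous
    { toFun := fun x => ⟨⟨fun γ => φ γ x, memℓp_infty ⟨C * ‖x‖, by
          rintro _ ⟨γ, rfl⟩
          exact hC γ x⟩⟩, h0 x⟩
      map_add' := fun x y => by
        refine Subtype.ext (lp.ext (funext fun γ => ?_))
        exact map_add (φ γ) x y
      map_smul' := fun c x => by
        refine Subtype.ext (lp.ext (funext fun γ => ?_))
        exact map_smul (φ γ) c x } (max C 0) fun x => by
    refine lp.norm_le_of_forall_le (by positivity) fun γ => ?_
    exact (hC γ x).trans (mul_le_mul_of_nonneg_right (le_max_left _ _) (norm_nonneg x))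

/-! ### The antisymmetrised difference functionals -/

/-- The functional `∑_σ sgn σ · (δ_{x_{σ 1}} - δ_p) ⊗ ⋯ ⊗ (δ_{x_{σ n}} - δ_p)` on functions on
`K^n`, with the products expanded over the sets `A` of coordinates replaced by `p`. -/
noncomputable def alternatingDifference {K : Type*} {n : ℕ} (p : K) (x : Fin n → K)
    (f : (Fin n → K) → ℝ) : ℝ :=
  ∑ σ : Equiv.Perm (Fin n), ∑ A : Finset (Fin n),
    ((Equiv.Perm.sign σ : ℤ) : ℝ) * (-1) ^ A.card * f (A.piecewise (fun _ => p) (x ∘ σ))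

section AlternatingDifference

variable {K : Type*} {n : ℕ} {p : K}

theorem alternatingDifference_eq_zero_of_eq {x : Fin n → K} {i j : Fin n} (hij : i ≠ j)
    (hx : x i = x j) (f : (Fin n → K) → ℝ) : alternatingDifference p x f = 0 := by
  have hswap : x ∘ Equiv.swap i j = x := by
    funext k
    rcases eq_or_ne k i with rfl | hki
    · simp [hx]
    · rcases eq_or_ne k j with rfl | hkj
      · simp [hx]
      · simp [Equiv.swap_apply_of_ne_of_ne hki hkj]
  have h : alternatingDifference p x f = -alternatingDifference p x f := by
    conv_lhs => rw [alternatingDifference, ← Equiv.sum_comp (Equiv.mulLeft (Equiv.swap i j))]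
    rw [alternatingDifference, ← Finset.sum_neg_distrib]
    refine Finset.sum_congr rfl fun σ _ => ?_
    rw [← Finset.sum_neg_distrib]
    refine Finset.sum_congr rfl fun A _ => ?_
    have hcomp : x ∘ ⇑(Equiv.swap i j * σ) = x ∘ σ := by
      rw [Equiv.Perm.coe_mul, ← Function.comp_assoc, hswap]
    rw [Equiv.coe_mulLeft, hcomp]
    simp [Equiv.Perm.sign_swap hij]
  linarith

theorem alternatingDifference_eq_zero_of_eq_point {x : Fin n → K} {i : Fin n} (hx : x i = p)
    (f : (Fin n → K) → ℝ) : alternatingDifference p x f = 0 := by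
  refine Finset.sum_eq_zero fun σ _ => ?_
  -- Toggling membership of the coordinate `k` does not move the point and changes the sign.
  obtain ⟨k, hxk⟩ : ∃ k, x (σ k) = p := ⟨σ.symm i, by simp [hx]⟩
  refine Finset.sum_involution (fun A _ => symmDiff A {k}) ?_ ?_ (fun _ _ => Finset.mem_univ _) ?_
  · intro A _
    have hpt : (symmDiff A {k}).piecewise (fun _ => p) (x ∘ σ) =
        A.piecewise (fun _ => p) (x ∘ σ) := by
      funext l
      rcases eq_or_ne k l with rfl | hl
      · by_cases h : k ∈ A <;> simp [Finset.piecewise, Finset.mem_symmDiff, h, hxk]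
      · by_cases h : l ∈ A <;> simp [Finset.piecewise, Finset.mem_symmDiff, h, hl.symm]
    have hcard : (-1 : ℝ) ^ (symmDiff A {k}).card = -(-1) ^ A.card := by
      by_cases h : k ∈ A
      · have : symmDiff A {k} = A.erase k := by
          ext l
          grind [Finset.mem_symmDiff]
        rw [this, ← Finset.card_erase_add_one h, pow_succ]
        ring
      · have : symmDiff A {k} = insert k A := by
          ext l
          grind [Finset.mem_symmDiff]
        rw [this, Finset.card_insert_of_notMem h, pow_succ]
        ring
    rw [hpt, hcard]
    ring
  · intro A _ _ h
    have : k ∈ symmDiff A {k} ↔ k ∈ A := by rw [h]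
    by_cases hkA : k ∈ A <;> simp [Finset.mem_symmDiff, hkA] at this
  · intro A _
    exact symmDiff_symmDiff_cancel_right {k} A

theorem alternatingDifference_eq_apply {x : Fin n → K} {f : (Fin n → K) → ℝ}
    (hf : ∀ (σ : Equiv.Perm (Fin n)) (A : Finset (Fin n)), (σ ≠ 1 ∨ A ≠ ∅) →
      f (A.piecewise (fun _ => p) (x ∘ σ)) = 0) : alternatingDifference p x f = f x := by
  rw [alternatingDifference, Finset.sum_eq_single 1, Finset.sum_eq_single ∅]
  · simp
  · intro A _ hA
    rw [hf 1 A (Or.inr hA), mul_zero]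
  · simp
  · intro σ _ hσ
    exact Finset.sum_eq_zero fun A _ => by rw [hf σ A (Or.inl hσ), mul_zero]
  · simp

/-- `alternatingDifference` as a linear functional of the continuous function. -/
noncomputable def alternatingDifferenceLM [TopologicalSpace K] (p : K) (x : Fin n → K) :
    C(Fin n → K, ℝ) →ₗ[ℝ] ℝ where
  toFun f := alternatingDifference p x f
  map_add' f g := by
    simp only [alternatingDifference, ContinuousMap.add_apply, mul_add, Finset.sum_add_distrib]
  map_smul' c f := by
    simp only [alternatingDifference, ContinuousMap.smul_apply, smul_eq_mul, RingHom.id_apply,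
      Finset.mul_sum]
    exact Finset.sum_congr rfl fun σ _ => Finset.sum_congr rfl fun A _ => by ring

theorem abs_alternatingDifference_le [TopologicalSpace K] [CompactSpace K] (x : Fin n → K)
    (f : C(Fin n → K, ℝ)) : |alternatingDifference p x f| ≤
      (∑ _σ : Equiv.Perm (Fin n), ∑ _A : Finset (Fin n), (1 : ℝ)) * ‖f‖ := by
  simp only [Finset.sum_mul]
  refine (Finset.abs_sum_le_sum_abs _ _).trans (Finset.sum_le_sum fun σ _ => ?_)
  refine (Finset.abs_sum_le_sum_abs _ _).trans (Finset.sum_le_sum fun A _ => ?_)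
  have hsign : |((Equiv.Perm.sign σ : ℤ) : ℝ)| = 1 := by
    rcases Int.units_eq_one_or (Equiv.Perm.sign σ) with h | h <;> simp [h]
  rw [abs_mul, abs_mul, hsign, abs_pow, abs_neg, abs_one, one_pow, one_mul]
  exact mul_le_mul_of_nonneg_left (f.norm_coe_le_norm _) zero_le_one

theorem continuous_alternatingDifference [TopologicalSpace K] (p : K) (f : C(Fin n → K, ℝ)) :
    Continuous fun x : Fin n → K => alternatingDifference p x f := by
  refine continuous_finsetSum _ fun σ _ => continuous_finsetSum _ fun A _ =>
    continuous_const.mul (f.continuous.comp (continuous_pi fun i => ?_))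
  by_cases h : i ∈ A
  · simpa [Finset.piecewise, h] using continuous_const
  · simpa [Finset.piecewise, h] using continuous_apply (σ i)

end AlternatingDifference

/-! ### Preimages of the countable ordinals -/

theorem omega0_mul_add_natCast_lt_omega_one {α : Ordinal.{0}} (hα : α < ω₁) (k : ℕ) :
    ω * α + k < ω₁ :=
  Ordinal.isPrincipal_add_omega 1
    (Ordinal.isPrincipal_mul_omega 1 Ordinal.omega0_lt_omega_one hα)
    ((Ordinal.natCast_lt_omega0 k).trans Ordinal.omega0_lt_omega_one)

/-- The `i`-th isolated point of the `α`-th block `[ω·α, ω·(α+1))` of countable ordinals. -/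
noncomputable def blockPoint (α : CountableOrdinals) (i : ℕ) : CountableOrdinals :=
  ⟨ω * α.1 + (i + 1 : ℕ), omega0_mul_add_natCast_lt_omega_one α.2 (i + 1)⟩

theorem blockPoint_lt_of_lt {α β : CountableOrdinals} (h : α < β) (i : ℕ) :
    (blockPoint α i).1 < ω * β.1 :=
  calc ω * α.1 + (i + 1 : ℕ) < ω * α.1 + ω := by
        gcongr
        exact Ordinal.natCast_lt_omega0 _
    _ = ω * Order.succ α.1 := (Ordinal.mul_succ _ _).symm
    _ ≤ ω * β.1 := by
        gcongr
        exact Order.succ_le_of_lt h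

theorem blockPoint_inj {α β : CountableOrdinals} {i j : ℕ} (h : blockPoint α i = blockPoint β j) :
    α = β ∧ i = j := by
  have key : ∀ {α β : CountableOrdinals} {i j : ℕ}, α < β → blockPoint α i ≠ blockPoint β j := by
    intro α β i j hlt heq
    have h1 := blockPoint_lt_of_lt hlt i
    rw [heq] at h1
    exact absurd h1 (not_lt.2 le_self_add)
  obtain rfl : α = β := by
    rcases lt_trichotomy α β with hlt | rfl | hlt
    · exact absurd h (key hlt)
    · rfl
    · exact absurd h.symm (key hlt)
  refine ⟨rfl, ?_⟩
  have h2 : ω * α.1 + ((i + 1 : ℕ) : Ordinal) = ω * α.1 + ((j + 1 : ℕ) : Ordinal) :=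
    congrArg Subtype.val h
  have h3 := Nat.cast_injective (add_left_cancel h2)
  omega

theorem isOpen_singleton_blockPoint (α : CountableOrdinals) (i : ℕ) :
    IsOpen {blockPoint α i} := by
  have h : IsOpen {(blockPoint α i).1} := by
    refine SuccOrder.isOpen_singleton_iff.2 fun hlim => ?_
    have h2 : (blockPoint α i).1 = Order.succ (ω * α.1 + (i : Ordinal)) := by
      simp [blockPoint, Order.succ_eq_add_one, add_assoc]
    rw [h2] at hlim
    exact Order.not_isSuccLimit_succ _ hlim
  convert h.preimage continuous_subtype_val
  ext x
  simp [Subtype.ext_iff]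

/-- Along a strictly increasing sequence of blocks, all block points converge to the supremum of
the blocks. -/
theorem exists_tendsto_blockPoint {a : ℕ → CountableOrdinals} (ha : StrictMono a) :
    ∃ γ : CountableOrdinals, ∀ i, Tendsto (fun k => blockPoint (a k) i) atTop (𝓝 γ) := by
  have hlt : ∀ k, ω * (a k).1 < ω₁ := fun k => by
    simpa using omega0_mul_add_natCast_lt_omega_one (a k).2 0
  have hbdd : BddAbove (range fun k => ω * (a k).1) := by
    refine ⟨ω₁, ?_⟩
    rintro _ ⟨k, rfl⟩
    exact (hlt k).le
  have hmono : Monotone fun k => ω * (a k).1 := fun k l hkl => by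
    have : (a k).1 ≤ (a l).1 := ha.monotone hkl
    dsimp only
    gcongr
  have hlim := tendsto_atTop_ciSup hmono hbdd
  refine ⟨⟨_, Ordinal.iSup_lt_omega_one hlt⟩, fun i => tendsto_subtype_rng.2 ?_⟩
  refine tendsto_of_tendsto_of_tendsto_of_le_of_le hlim (hlim.comp (tendsto_add_atTop_nat 1))
    (fun k => le_self_add) fun k => ?_
  exact (blockPoint_lt_of_lt (ha (Nat.lt_succ_self k)) i).le

theorem Set.Infinite.exists_strictMono_nat {α : Type*} [LinearOrder α] [WellFoundedLT α]
    {s : Set α} (hs : s.Infinite) : ∃ a : ℕ → α, StrictMono a ∧ ∀ k, a k ∈ s := by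
  have := hs.to_subtype
  obtain ⟨f, hf | hf⟩ := Infinite.exists_strictMono_or_strictAnti s
  · exact ⟨fun k => f k, fun k l h => hf h, fun k => (f k).2⟩
  · exact absurd hf (not_strictAnti_of_wellFoundedLT f)

/-- The functionals attached to the blocks form a weak-* null family: an infinite set of blocks
contains a strictly increasing sequence, along which the tuples accumulate at a tuple that either
has a coordinate equal to `p` or lies over a single ordinal `γ`. As fewer than `n` points lie over
`γ`, the latter tuple has two equal coordinates, so the functional vanishes at the limit. -/
theorem tendsto_alternatingDifference {K : Type*} [TopologicalSpace K] [CompactSpace K] {n : ℕ}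
    (hn : n ≠ 0) {p : K} {φ : {x : K // x ≠ p} → CountableOrdinals} (hφ : Continuous φ)
    (hone : IsToOne (n - 1) φ) {x : CountableOrdinals → Fin n → {x : K // x ≠ p}}
    (hx : ∀ α i, φ (x α i) = blockPoint α i) (f : C(Fin n → K, ℝ)) :
    Tendsto (fun α => alternatingDifference p (fun i => (x α i : K)) f) cofinite (𝓝 0) := by
  rw [Metric.tendsto_nhds]
  intro ε hε
  by_contra hinf
  obtain ⟨a, ha, hbig⟩ := Set.Infinite.exists_strictMono_nat hinf
  obtain ⟨γ, hγ⟩ := exists_tendsto_blockPoint ha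
  let F : Ultrafilter ℕ := hyperfilter ℕ
  have hF : (F : Filter ℕ) ≤ atTop := Nat.hyperfilter_le_atTop
  let u : ℕ → Fin n → K := fun k i => x (a k) i
  obtain ⟨z, -, hz⟩ := isCompact_univ.ultrafilter_le_nhds (F.map u) (by simp)
  have hz' : Tendsto u F (𝓝 z) := hz
  have hlim := ((continuous_alternatingDifference p f).tendsto z).comp hz'
  have hzero : alternatingDifference p z f = 0 := by
    by_cases hp : ∃ i, z i = p
    · obtain ⟨i, hi⟩ := hp
      exact alternatingDifference_eq_zero_of_eq_point hi f
    · push Not at hp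
      have hfib : ∀ i, φ ⟨z i, hp i⟩ = γ := by
        intro i
        have h1 : Tendsto (fun k => x (a k) i) F (𝓝 ⟨z i, hp i⟩) :=
          tendsto_subtype_rng.2 ((continuous_apply i).tendsto z |>.comp hz')
        have h2 := (hφ.tendsto _).comp h1
        refine tendsto_nhds_unique h2 (((hγ i).mono_left hF).congr fun k => ?_)
        exact (hx (a k) i).symm
      by_contra hne
      have hinj : Function.Injective fun i => (⟨z i, hp i⟩ : {x : K // x ≠ p}) := by
        intro i j hij
        by_contra hij'
        exact hne (alternatingDifference_eq_zero_of_eq hij' (congrArg Subtype.val hij) f)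
      have hcard : (n : ℕ∞) ≤ (n - 1 : ℕ) :=
        calc (n : ℕ∞) = (range fun i => (⟨z i, hp i⟩ : {x : K // x ≠ p})).encard := by
              rw [← image_univ, hinj.encard_image]
              simp
          _ ≤ (φ ⁻¹' {γ}).encard := encard_le_encard (by
              rintro _ ⟨i, rfl⟩
              exact hfib i)
          _ ≤ (n - 1 : ℕ) := by simpa using hone γ
      have := Nat.cast_le.1 hcard
      omega
  have hev := (Metric.tendsto_nhds.1 hlim) ε hε
  obtain ⟨k, hk⟩ := hev.exists
  refine hbig k ?_
  rw [hzero] at hk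
  exact hk

theorem hasComplementedCopy_of_isToOne {K : Type*} [TopologicalSpace K] [CompactSpace K]
    [T2Space K] [TotallyDisconnectedSpace K] {n : ℕ} {p : K}
    {φ : {x : K // x ≠ p} → CountableOrdinals} (hφ : Continuous φ) (hsurj : Function.Surjective φ)
    (hone : IsToOne (n - 1) φ) : HasComplementedCopy (cZero CountableOrdinals) C(Fin n → K, ℝ) := by
  -- For `n = 0` the truncated `n - 1` is `0`, and no `0`-to-`1` map is surjective.
  have hn : n ≠ 0 := by
    rintro rfl
    obtain ⟨y, -⟩ := hsurj (blockPoint ⟨0, Ordinal.omega_pos 1⟩ 0)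
    have h := hone (φ y)
    simp only [zero_tsub, CharP.cast_eq_zero, nonpos_iff_eq_zero, encard_eq_zero] at h
    exact (h ▸ (rfl : φ y = φ y) : y ∈ (∅ : Set _))
  have hex : ∀ (α : CountableOrdinals) (i : Fin n), ∃ y, φ y = blockPoint α i := fun α i => hsurj _
  choose x hx using hex
  have hVex : ∀ (α : CountableOrdinals) (i : Fin n), ∃ V : Set K, IsClopen V ∧ (x α i : K) ∈ V ∧
      V ⊆ Subtype.val '' (φ ⁻¹' {blockPoint α i}) := fun α i =>
    compact_exists_isClopen_in_isOpen (isOpen_ne.isOpenMap_subtype_val _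
      ((isOpen_singleton_blockPoint α i).preimage hφ)) ⟨x α i, hx α i, rfl⟩
  choose V hV hxV hVsub using hVex
  have hVφ : ∀ {α i y}, y ∈ V α i → ∃ hy : y ≠ p, φ ⟨y, hy⟩ = blockPoint α i := by
    intro α i y hy
    obtain ⟨⟨y', hy'⟩, h, rfl⟩ := hVsub α i hy
    exact ⟨hy', h⟩
  let U : CountableOrdinals → Set (Fin n → K) := fun α => univ.pi (V α)
  have hUclopen : ∀ α, IsClopen (U α) := fun α =>
    ⟨isClosed_set_pi fun i _ => (hV α i).isClosed,
      isOpen_set_pi finite_univ fun i _ => (hV α i).isOpen⟩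
  have hUdisj : Pairwise fun α β => Disjoint (U α) (U β) := by
    intro α β hne
    refine disjoint_left.2 fun y hy hy' => hne ?_
    let i : Fin n := ⟨0, Nat.pos_of_ne_zero hn⟩
    obtain ⟨h1, h2⟩ := hVφ (hy i trivial)
    obtain ⟨_, h4⟩ := hVφ (hy' i trivial)
    exact (blockPoint_inj (h2.symm.trans h4)).1
  -- Only the trivial permutation and the empty set contribute at the points `x α`.
  have hpt : ∀ (α β : CountableOrdinals) (σ : Equiv.Perm (Fin n)) (A : Finset (Fin n)),
      A.piecewise (fun _ => p) ((fun i => (x α i : K)) ∘ σ) ∈ U β → σ = 1 ∧ A = ∅ := by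
    intro α β σ A hmem
    have hA : A = ∅ := by
      refine Finset.eq_empty_of_forall_notMem fun i hi => ?_
      obtain ⟨h, -⟩ := hVφ (hmem i trivial)
      exact h (by simp [hi])
    subst hA
    refine ⟨Equiv.ext fun i => ?_, rfl⟩
    have hi := hmem i trivial
    rw [Finset.piecewise_empty] at hi
    obtain ⟨_, h⟩ := hVφ hi
    exact Fin.ext (blockPoint_inj ((hx α (σ i)).symm.trans h)).2
  refine hasComplementedCopy_of_leftInverse (spreadCLM hUdisj hUclopen)
    (toCZero (fun α => alternatingDifferenceLM p fun i => (x α i : K)) _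
      (fun α f => abs_alternatingDifference_le _ f)
      (tendsto_alternatingDifference hn hφ hone hx)) fun f => ?_
  refine Subtype.ext (lp.ext (funext fun α => ?_))
  change alternatingDifference p _ _ = _
  rw [alternatingDifference_eq_apply, spreadCLM_apply,
    spread_of_mem hUdisj _ (show (fun i => (x α i : K)) ∈ U α from fun i _ => hxV α i)]
  intro σ A hσA
  rw [spreadCLM_apply, spread_of_notMem]
  intro β hβ
  obtain ⟨h1, h2⟩ := hpt α β σ A hβ
  exact hσA.elim (fun h => h h1) fun h => h h2

instance CountableOrdinals.instUncountable : Uncountable CountableOrdinals := by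
  rw [← Cardinal.aleph0_lt_mk_iff, Cardinal.mk_Iio_ordinal]
  simp

theorem mainTheorem4 {K : Type*} [TopologicalSpace K] [CompactSpace K] [T2Space K]
    [TotallyDisconnectedSpace K] (n : ℕ) :
    (IsScattered K → IsDiverseSpace (n + 1) K → IsHalfPcc C(Fin n → K, ℝ)) ∧
    (IsHalfPcc C(Fin n → K, ℝ) →
      ¬ HasComplementedCopy (cZero CountableOrdinals) C(Fin n → K, ℝ)) ∧
    (¬ HasComplementedCopy (cZero CountableOrdinals) C(Fin n → K, ℝ) →
      ¬ ∃ (p : K) (φ : {x : K // x ≠ p} → CountableOrdinals),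
        Continuous φ ∧ Function.Surjective φ ∧ IsToOne (n - 1) φ) :=
  ⟨isHalfPcc_of_isDiverseSpace, not_hasComplementedCopy_of_isHalfPcc,
    fun h ⟨_, _, hφ, hsurj, hone⟩ => h (hasComplementedCopy_of_isToOne hφ hsurj hone)⟩
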